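/- All groups are finite. A formation is an isomorphism-closed (possibly empty) class $\mathfrak X$ of finite groups that is closed under quotients and such that $G/(M\cap N)\in\mathfrak X$ whenever $M,N\trianglelefteq G$ and $G/M,\,G/N\in\mathfrak X$; it is saturated if $G/\Phi(G)\in\mathfrak X$ implies $G\in\mathfrak X$, where $\Phi(G)$ is the Frattini subgroup. Let $\mathfrak F$ be a saturated formation of finite soluble groups with an integrated local definition $f$. That is, for each prime $p$, $f(p)$ is a (possibly empty) formation contained in $\mathfrak F$, and $\mathfrak F$ is the class of all finite soluble groups $G$ such that $G/C_G(A/B)\in f(p)$ for every prime $p$ and every chief factor $A/B$ of $G$ of $p$-power order. Let $F$ be a field of prime characteristic $p$. For a finite group $U$, an irreducible $FU$-module $A$ is called $(U,\mathfrak F)$-central if $U/C_U(A)\in f(p)$, where $C_U(A)$ is the kernel of the action, and $(U,\mathfrak F)$-eccentric otherwise. An $FU$-module is $(U,\mathfrak F)$-hypercentral (respectively $(U,\mathfrak F)$-hypereccentric) if all its composition factors (that is, irreducible subquotients) are central (respectively eccentric). **Theorem.** Let $G$ be an arbitrary (not necessarily soluble) finite group, let $U$ be a normal subgroup of $G$ with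 $U\in\mathfrak F$, and let $V$ be an $FG$-module. Then $V$, viewed as an $FU$-module, has a unique decomposition $V=V^+\oplus V^-$ into a $(U,\mathfrak F)$-hypercentral $FU$-submodule $V^+$ and a $(U,\mathfrak F)$-hypereccentric $FU$-submodule $V^-$ (the $(U,\mathfrak F)$-components of $V$), and both $V^+$ and $V^-$ are $FG$-submodules of $V$. This fails if $U$ is only assumed to be subnormal in $G$. Let $\mathfrak F$ be the class of all finite nilpotent groups, which is a saturated formation of soluble groups with the integrated local definition $f(q)=\{1\}$ for all primes $q$. Let $G$ be the group of permutations of $\{e_1,\dots,e_6\}$ generated by the permutations of $\{e_1,e_2,e_3\}$ and the permutation $(14)(25)(36)$, and let $U=\langle(123)\rangle$. Then $U$ is subnormal in $G$ and $U\in\mathfrak F$. For every field $F$ of characteristic $2$, if $V$ is the permutation module over $F$ with basis $e_1,\dots,e_6$, then the $(U,\mathfrak F)$-components of $V$ are $V^+=\langle e_1+e_2+e_3,\,e_4,\,e_5,\,e_6\rangle$ and $V^-=\langle e_1+e_2,\,e_2+e_3\rangle$, and neither of them is an $FG$-submodule of $V$. -/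

import Mathlib

universe u v w

/-! ### Classes of groups, formations, local definitions -/

/-- A class of groups (in a fixed universe). -/
abbrev GroupClass : Type (u + 1) := ∀ (G : Type u) [Group G], Prop

/-- A formation: an isomorphism-closed (possibly empty) class of finite groups that is closed under
quotients and such that `G ⧸ (M ⊓ N)` belongs to it whenever `G ⧸ M` and `G ⧸ N` do. -/
structure IsFormation (X : GroupClass.{u}) : Prop where
  finite : ∀ (G : Type u) [Group G], X G → Finite G
  iso : ∀ (G H : Type u) [Group G] [Group H], (G ≃* H) → X G → X H
  quotient : ∀ (G : Type u) [Group G] (N : Subgroup G) [N.Normal], X G → X (G ⧸ N)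
  inf : ∀ (G : Type u) [Group G] [Finite G] (M N : Subgroup G) [M.Normal] [N.Normal],
    X (G ⧸ M) → X (G ⧸ N) → X (G ⧸ (M ⊓ N))

/-- A saturated formation: a finite group `G` belongs to it as soon as `G ⧸ Φ(G)` does, where
`Φ(G)` is the Frattini subgroup. -/
structure IsSaturatedFormation (X : GroupClass.{u}) : Prop extends IsFormation X where
  saturated : ∀ (G : Type u) [Group G] [Finite G], X (G ⧸ frattini G) → X G

/-- `A / B` is a chief factor of `G`: `B < A` are normal subgroups of `G` and no normal subgroup of
`G` lies strictly between them. -/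
def IsChiefFactor {G : Type u} [Group G] (A B : Subgroup G) [A.Normal] [B.Normal] : Prop :=
  B < A ∧ ∀ N : Subgroup G, N.Normal → B ≤ N → N ≤ A → N = B ∨ N = A

/-- The centraliser `C_G(A / B)` in `G` of the factor `A / B`: the elements of `G` whose image in
`G ⧸ B` commutes with every element of the image of `A`. -/
def factorCentralizer {G : Type u} [Group G] (A B : Subgroup G) [B.Normal] : Subgroup G :=
  (Subgroup.centralizer (A.map (QuotientGroup.mk' B) : Set (G ⧸ B))).comap (QuotientGroup.mk' B)

instance factorCentralizer_normal {G : Type u} [Group G] (A B : Subgroup G)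
    [A.Normal] [B.Normal] : (factorCentralizer A B).Normal := by
  have : (A.map (QuotientGroup.mk' B)).Normal :=
    Subgroup.Normal.map inferInstance _ (QuotientGroup.mk'_surjective B)
  unfold factorCentralizer
  infer_instance

/-- `Loc f`: the class of finite soluble groups `G` such that `G / C_G(A/B) ∈ f(p)` for every prime
`p` and every chief factor `A / B` of `G` of `p`-power order. -/
def Loc (f : Nat.Primes → GroupClass.{u}) : GroupClass.{u} := fun G _ =>
  Finite G ∧ Group.IsSolvable G ∧
    ∀ (p : Nat.Primes) (A B : Subgroup G) [A.Normal] [B.Normal], IsChiefFactor A B →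
      (∃ k : ℕ, B.relIndex A = (p : ℕ) ^ k) → f p (G ⧸ factorCentralizer A B)

/-- `X` is a saturated formation of finite soluble groups and `f` is an integrated local definition
of it: each `f p` is a (possibly empty) formation, `X = Loc f`, and `f p ⊆ Loc f`. -/
structure IsIntegratedLocalDefinition (X : GroupClass.{u}) (f : Nat.Primes → GroupClass.{u}) :
    Prop where
  saturatedFormation : IsSaturatedFormation X
  soluble : ∀ (G : Type u) [Group G], X G → Group.IsSolvable G
  formation : ∀ p, IsFormation (f p)
  eq_loc : ∀ (G : Type u) [Group G], X G ↔ Loc f G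
  integrated : ∀ (p : Nat.Primes) (G : Type u) [Group G], f p G → Loc f G

/-! ### Central and eccentric modules

An `FG`-module is a representation `ρ : Representation F G V`, and its `FG`-submodules are the
terms of `Subrepresentation ρ`. -/

section Modules

variable {F : Type w} [Field F] {G : Type u} [Group G] {V : Type v} [AddCommGroup V] [Module F V]

/-- For subrepresentations `A`, `B` of `ρ` (meant for `A ≤ B`), the representation on `B / A`. -/
def factorRep {ρ : Representation F G V} (A B : Subrepresentation ρ) :
    Representation F G (B.toSubmodule ⧸ A.toSubmodule.comap B.toSubmodule.subtype) :=
  B.toRepresentation.quotient (A.toSubmodule.comap B.toSubmodule.subtype)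
    (fun g x hx => A.apply_mem_toSubmodule g (v := (x : V)) hx)

/-- The condition `G / C_G(V) ∈ f(p)`; for an irreducible module over a field of characteristic `p`
this says that the module is central, and its negation that it is eccentric. -/
def IsCentralModule (f : Nat.Primes → GroupClass.{u}) (p : Nat.Primes)
    (ρ : Representation F G V) : Prop :=
  f p (G ⧸ MonoidHom.ker ρ)

/-- Every composition factor `B / A` of the module is central. (`A ⋖ B`, that is `B` covers `A` in
the lattice of submodules, says that `B / A` is irreducible.) -/
def IsHypercentral (f : Nat.Primes → GroupClass.{u}) (p : Nat.Primes)
    (ρ : Representation F G V) : Prop :=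
  ∀ A B : Subrepresentation ρ, A ⋖ B → IsCentralModule f p (factorRep A B)

/-- Every composition factor of the module is eccentric. -/
def IsHypereccentric (f : Nat.Primes → GroupClass.{u}) (p : Nat.Primes)
    (ρ : Representation F G V) : Prop :=
  ∀ A B : Subrepresentation ρ, A ⋖ B → ¬ IsCentralModule f p (factorRep A B)

/-- `P` and `M` are the components `V⁺` and `V⁻` of the module: `V = P ⊕ M` with `P` hypercentral and
`M` hypereccentric. -/
structure AreComponents (f : Nat.Primes → GroupClass.{u}) (p : Nat.Primes)
    {ρ : Representation F G V} (P M : Subrepresentation ρ) : Prop where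
  isCompl : IsCompl P M
  hypercentral : IsHypercentral f p P.toRepresentation
  hypereccentric : IsHypereccentric f p M.toRepresentation

/-- The `FG`-module `V` viewed as an `FU`-module. -/
abbrev restrictTo (ρ : Representation F G V) (U : Subgroup G) : Representation F U V :=
  ρ.comp U.subtype

/-- The subspace `W` is an `FG`-submodule. -/
def IsStableUnder (ρ : Representation F G V) (W : Submodule F V) : Prop :=
  ∀ g : G, ∀ x ∈ W, ρ g x ∈ W

end Modules

/-! ### The example with a subnormal subgroup

The six symbols are `0, …, 5 : Fin 6`. -/

/-- The class of finite nilpotent groups. -/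
def FiniteNilpotent : GroupClass.{u} := fun G _ => Finite G ∧ Group.IsNilpotent G

/-- The formation function whose value at every prime is the class of trivial groups. -/
def trivialFormation : Nat.Primes → GroupClass.{u} := fun _ G _ => Subsingleton G

/-- The group generated by the permutations of the first three symbols (fixing the other three) and
the permutation `(0 3)(1 4)(2 5)`. -/
def exampleG : Subgroup (Equiv.Perm (Fin 6)) :=
  Subgroup.closure ({s | ∀ i : Fin 6, 3 ≤ i → s i = i} ∪
    {Equiv.swap 0 3 * Equiv.swap 1 4 * Equiv.swap 2 5})

/-- The subgroup of `exampleG` generated by the three-cycle `(0 1 2)`. -/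
def exampleU : Subgroup exampleG :=
  (Subgroup.zpowers (Equiv.swap 0 1 * Equiv.swap 1 2 : Equiv.Perm (Fin 6))).subgroupOf exampleG

/-- The permutation module of `exampleG` over `F`: the basis vector of the symbol `i` is sent by `g`
to the basis vector of the symbol `g i`. -/
noncomputable def exampleV (F : Type w) [Field F] : Representation F exampleG (Fin 6 →₀ F) where
  toFun g := Finsupp.lmapDomain F F (g : Equiv.Perm (Fin 6))
  map_one' := by ext; simp
  map_mul' g h := by ext; simp

/-- The basis vector belonging to the symbol `i`. -/
noncomputable abbrev exampleBasis (F : Type w) [Field F] (i : Fin 6) : Fin 6 →₀ F :=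
  Finsupp.single i 1

/-! Let `K` be the `f(p)`-residual of `U`. Since `U` lies in `Loc f`, `K` centralises every chief
factor of `U` of `p`-power order, and this makes `K` `p`-nilpotent: it has a normal `p`-complement
`N` (`exists_normal_complement`). An irreducible `FU`-module is central iff `K` acts trivially on
it, and this happens iff `N` does, because a `p`-group such as `K/N` has nonzero fixed vectors in
characteristic `p` (`smul_sub_mem_of_covBy`).

As `|N|` is invertible in `F`, the operator `s = ∑ n`, summed over `N`, splits any module, as in
Maschke's theorem, into the fixed vectors of `N` and the kernel of `s`. Hypercentral means that `N`
acts trivially and hypereccentric that `s = 0`, so these two pieces are the only possible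
components. Finally `N` is characteristic in `U`, hence invariant under conjugation by `G`, so both
pieces are `G`-stable. If no quotient of `U` lies in `f(p)`, there is no residual, but then every
module is hypereccentric.

In the example the residual of `U` is `U` itself, of order 3, and the permutation interchanging the
two blocks does not normalise it. -/

/-! ### Chief factors of finite soluble groups -/

theorem Subgroup.pow_card_eq_one_of_mem {G : Type u} [Group G] (H : Subgroup G) {x : G}
    (hx : x ∈ H) : x ^ Nat.card H = 1 :=
  congrArg Subtype.val (pow_card_eq_one' (x := (⟨x, hx⟩ : H)))

theorem IsChiefFactor.map_minimal {G : Type u} [Group G] {R L : Subgroup G} [R.Normal] [L.Normal]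
    (h : IsChiefFactor R L) (N : Subgroup (G ⧸ L)) (hN : N.Normal)
    (hle : N ≤ R.map (QuotientGroup.mk' L)) : N = ⊥ ∨ N = R.map (QuotientGroup.mk' L) := by
  have hs := QuotientGroup.mk'_surjective L
  have key : N = (N.comap (QuotientGroup.mk' L)).map (QuotientGroup.mk' L) :=
    (Subgroup.map_comap_eq_self_of_surjective hs N).symm
  have h1 : L ≤ N.comap (QuotientGroup.mk' L) := by
    simpa using (QuotientGroup.mk' L).ker_le_comap N
  have h2 : N.comap (QuotientGroup.mk' L) ≤ R := by
    have := Subgroup.comap_mono (f := QuotientGroup.mk' L) hle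
    rwa [QuotientGroup.comap_map_mk', sup_eq_right.2 h.1.le] at this
  rcases h.2 _ inferInstance h1 h2 with h3 | h3
  · left; rw [key, h3]; simp
  · right; rw [key, h3]

theorem card_eq_prime_pow_of_minimal_normal {H : Type u} [Group H] [Finite H] [Group.IsSolvable H]
    (M : Subgroup H) [M.Normal] (hM : M ≠ ⊥)
    (hmin : ∀ N : Subgroup H, N.Normal → N ≤ M → N = ⊥ ∨ N = M) :
    ∃ q k : ℕ, q.Prime ∧ Nat.card M = q ^ k := by
  have hcomm : ⁅M, M⁆ = ⊥ :=
    (hmin _ inferInstance (Subgroup.commutator_le_left M M)).resolve_right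
      (Group.IsSolvable.commutator_lt_of_ne_bot hM).ne
  have hab : ∀ x ∈ M, ∀ y ∈ M, x * y = y * x := fun x hx y hy =>
    commutatorElement_eq_one_iff_mul_comm.1 (by
      simpa [hcomm] using Subgroup.commutator_mem_commutator hx hy)
  have hcard : Nat.card M ≠ 1 := fun h => hM (Subgroup.card_eq_one.1 h)
  obtain ⟨q, hqp, hqd⟩ := Nat.exists_prime_and_dvd hcard
  have := Fact.mk hqp
  obtain ⟨x, hx⟩ := exists_prime_orderOf_dvd_card' (G := M) q hqd
  -- The `q`-torsion of the abelian group `M` is normal in `H`, and nontrivial by Cauchy, so by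
  -- minimality it is all of `M`.
  let Q : Subgroup H :=
    { carrier := {y | y ∈ M ∧ y ^ q = 1}
      one_mem' := ⟨M.one_mem, one_pow _⟩
      mul_mem' := fun {a b} ha hb => ⟨M.mul_mem ha.1 hb.1, by
        rw [(show Commute a b from hab a ha.1 b hb.1).mul_pow, ha.2, hb.2, one_mul]⟩
      inv_mem' := fun {a} ha => ⟨M.inv_mem ha.1, by rw [inv_pow, ha.2, inv_one]⟩ }
  have hQn : Q.Normal := ⟨fun n hn g =>
    ⟨Subgroup.Normal.conj_mem ‹M.Normal› n hn.1 g, by rw [conj_pow, hn.2]; simp⟩⟩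
  have hQM : Q = M := by
    refine (hmin Q hQn fun y hy => hy.1).resolve_left fun h => ?_
    have hxQ : (x : H) ∈ Q := ⟨x.2, by
      rw [← Subgroup.coe_pow, ← hx, pow_orderOf_eq_one, Subgroup.coe_one]⟩
    rw [h, Subgroup.mem_bot] at hxQ
    have : x = 1 := Subtype.ext hxQ
    rw [this, orderOf_one] at hx
    exact hqp.one_lt.ne hx
  have hpg : IsPGroup q M := fun y => ⟨1, by
    have : (y : H) ∈ Q := hQM.ge y.2
    exact Subtype.ext (by simpa using this.2)⟩
  obtain ⟨k, hk⟩ := IsPGroup.iff_card.1 hpg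
  exact ⟨q, k, hqp, hk⟩

theorem relIndex_eq_card_map_mk {G : Type u} [Group G] (L R : Subgroup G) [L.Normal] :
    L.relIndex R = Nat.card (R.map (QuotientGroup.mk' L)) := by
  rw [← Subgroup.relIndex_ker, QuotientGroup.ker_mk']

theorem exists_chiefFactor {G : Type u} [Group G] [Finite G] [Group.IsSolvable G]
    {L T : Subgroup G} [L.Normal] [T.Normal] (h : L < T) :
    ∃ (R : Subgroup G) (_ : R.Normal), R ≤ T ∧ IsChiefFactor R L ∧
      ∃ q k : ℕ, q.Prime ∧ L.relIndex R = q ^ k := by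
  obtain ⟨R, hR⟩ := (Set.toFinite {R : Subgroup G | R.Normal ∧ L < R ∧ R ≤ T}).exists_minimal
    ⟨T, ‹_›, h, le_rfl⟩
  obtain ⟨⟨hn, hlt, hle⟩, hmin⟩ := hR
  have hc : IsChiefFactor R L := ⟨hlt, fun N hN hLN hNR => by
    rcases hLN.eq_or_lt with h1 | h1
    · exact .inl h1.symm
    · exact .inr (le_antisymm hNR (hmin ⟨hN, h1, hNR.trans hle⟩ hNR))⟩
  refine ⟨R, hn, hle, hc, ?_⟩
  rw [relIndex_eq_card_map_mk]
  have : (R.map (QuotientGroup.mk' L)).Normal :=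
    hn.map _ (QuotientGroup.mk'_surjective L)
  refine card_eq_prime_pow_of_minimal_normal _ (fun h0 => ?_) hc.map_minimal
  rw [Subgroup.map_eq_bot_iff, QuotientGroup.ker_mk'] at h0
  exact hlt.not_ge h0

/-! ### Normal `p`-complements -/

/-- Schur–Zassenhaus gives a complement `C` to `R` in `N`. Since `R` is central in `N` and of
coprime order, `C` is the full solution set of `x ^ |C| = 1` in `N`, hence invariant under
conjugation by `H`. -/
theorem exists_complement_of_central {H : Type u} [Group H] [Finite H] {p : ℕ}
    {N R : Subgroup H} [N.Normal] [R.Normal] (hRN : R ≤ N) (hcent : N ≤ Subgroup.centralizer R)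
    {k : ℕ} (hk : Nat.card R = p ^ k) (hco : (R.relIndex N).Coprime p) :
    ∃ Q : Subgroup H, Q.Normal ∧ Q ≤ N ∧ (Nat.card Q).Coprime p ∧ Q.relIndex N = p ^ k := by
  have hcR : Nat.card (R.subgroupOf N) = p ^ k := by
    rw [← hk]; exact Nat.card_congr (Subgroup.subgroupOfEquivOfLe hRN).toEquiv
  obtain ⟨C, hC⟩ := Subgroup.exists_right_complement'_of_coprime (N := R.subgroupOf N) (by
    rw [hcR]; exact (Nat.Coprime.pow_right k hco).symm)
  have hCcard : Nat.card C = R.relIndex N := hC.symm.index_eq_card.symm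
  set m := Nat.card C with hm
  have hmp : m.Coprime p := hCcard ▸ hco
  have hmem : ∀ x : N, x ∈ C ↔ x ^ m = 1 := by
    intro x
    refine ⟨fun hx => ?_, fun hx => ?_⟩
    · exact C.pow_card_eq_one_of_mem hx
    · obtain ⟨⟨r, c⟩, hrc⟩ := hC.2 x
      obtain ⟨r, hr⟩ := r
      obtain ⟨c, hc⟩ := c
      have hrc' : r * c = x := hrc
      have hcomm : Commute r c := by
        have := hcent c.2 (r : H) (Subgroup.mem_subgroupOf.1 hr)
        exact Subtype.ext this
      have hcm : c ^ m = 1 := C.pow_card_eq_one_of_mem hc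
      have hrm : r ^ m = 1 := by
        rw [← hx, ← hrc', hcomm.mul_pow, hcm, mul_one]
      have hrk : r ^ (p ^ k) = 1 := by
        rw [← hcR]; exact Subgroup.pow_card_eq_one_of_mem _ hr
      have hr1 : r = 1 := by
        have := Nat.dvd_gcd (orderOf_dvd_of_pow_eq_one hrm) (orderOf_dvd_of_pow_eq_one hrk)
        rw [(Nat.Coprime.pow_right k hmp)] at this
        exact orderOf_eq_one_iff.1 (Nat.dvd_one.1 this)
      rw [← hrc', hr1, one_mul]; exact hc
  refine ⟨C.map N.subtype, ⟨?_⟩, Subgroup.map_subtype_le C, ?_, ?_⟩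
  · rintro _ ⟨x, hx, rfl⟩ g
    refine ⟨⟨g * x * g⁻¹, Subgroup.Normal.conj_mem inferInstance _ x.2 g⟩, (hmem _).2 ?_, rfl⟩
    have hx' : (x : H) ^ m = 1 := by simpa [Subtype.ext_iff] using (hmem x).1 hx
    exact Subtype.ext (by simp [conj_pow, hx'])
  · rw [Subgroup.card_map_of_injective N.subtype_injective]; exact hmp
  · have : (C.map N.subtype).subgroupOf N = C := by
      ext x; simp [Subgroup.mem_subgroupOf]
    rw [Subgroup.relIndex, this, hC.index_eq_card, hcR]

theorem le_factorCentralizer_iff {G : Type u} [Group G] {K A B : Subgroup G} [B.Normal] :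
    K ≤ factorCentralizer A B ↔
      K.map (QuotientGroup.mk' B) ≤ Subgroup.centralizer (A.map (QuotientGroup.mk' B)) :=
  Subgroup.map_le_iff_le_comap.symm

/-- Descending induction on `L`: given a `p`-complement of `K/R` for a chief factor `R/L` below `K`,
pull it down to `K/L`. The case `L = ⊥` is the one wanted. -/
theorem exists_normal_complement_aux {U : Type u} [Group U] [Finite U] [Group.IsSolvable U]
    {p : ℕ} (hp : p.Prime) (K : Subgroup U) [K.Normal]
    (hK : ∀ (A B : Subgroup U) [A.Normal] [B.Normal], IsChiefFactor A B →
      (∃ k : ℕ, B.relIndex A = p ^ k) → K ≤ factorCentralizer A B)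
    (L : Subgroup U) (hL : L.Normal) (hLK : L ≤ K) :
    ∃ N : Subgroup U, N.Normal ∧ L ≤ N ∧ N ≤ K ∧ (L.relIndex N).Coprime p ∧
      ∃ k, N.relIndex K = p ^ k := by
  induction L using WellFoundedGT.induction with
  | ind L ih =>
  rcases hLK.eq_or_lt with rfl | hlt
  · exact ⟨L, hL, le_rfl, le_rfl, by simp, 0, by simp⟩
  obtain ⟨R, hRn, hRK, hchief, q, j, hq, hj⟩ := exists_chiefFactor hlt
  obtain ⟨N, hNn, hRN, hNK, hNR, k, hk⟩ := ih R hchief.1 hRn hRK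
  have hmul := Subgroup.relIndex_mul_relIndex L R N hchief.1.le hRN
  by_cases hqp : q = p
  -- `R/L` is a `p`-group centralised by `K`, so it is central in `N/L` and can be split off.
  · subst hqp
    have hs := QuotientGroup.mk'_surjective L
    have : (N.map (QuotientGroup.mk' L)).Normal := hNn.map _ hs
    have : (R.map (QuotientGroup.mk' L)).Normal := hRn.map _ hs
    have hc := le_factorCentralizer_iff.1 (hK R L hchief ⟨j, hj⟩)
    obtain ⟨Q, hQn, hQN, hQc, hQi⟩ := exists_complement_of_central
      (N := N.map (QuotientGroup.mk' L)) (R := R.map (QuotientGroup.mk' L))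
      (Subgroup.map_mono hRN) ((Subgroup.map_mono hNK).trans hc)
      (by rw [← relIndex_eq_card_map_mk, hj]) (by
        rw [← Subgroup.relIndex_comap, QuotientGroup.comap_map_mk', sup_eq_right.2 hchief.1.le]
        exact hNR)
    have hLQ : L ≤ Q.comap (QuotientGroup.mk' L) := by
      simpa using (QuotientGroup.mk' L).ker_le_comap Q
    have hQN' : Q.comap (QuotientGroup.mk' L) ≤ N := by
      have := Subgroup.comap_mono (f := QuotientGroup.mk' L) hQN
      rwa [QuotientGroup.comap_map_mk', sup_eq_right.2 (hchief.1.le.trans hRN)] at this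
    refine ⟨Q.comap (QuotientGroup.mk' L), inferInstance, hLQ, hQN'.trans hNK, ?_, j + k, ?_⟩
    · rw [relIndex_eq_card_map_mk, Subgroup.map_comap_eq_self_of_surjective hs]; exact hQc
    · rw [← Subgroup.relIndex_mul_relIndex _ N K hQN' hNK, Subgroup.relIndex_comap, hQi, hk, pow_add]
  -- `R/L` has order prime to `p`, so the same `N` still works.
  · refine ⟨N, hNn, hchief.1.le.trans hRN, hNK, ?_, k, hk⟩
    rw [← hmul, hj]
    exact Nat.Coprime.mul_left (Nat.Coprime.pow_left j ((Nat.coprime_primes hq hp).2 hqp)) hNR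

theorem exists_normal_complement {U : Type u} [Group U] [Finite U] [Group.IsSolvable U]
    {p : ℕ} (hp : p.Prime) (K : Subgroup U) [K.Normal]
    (hK : ∀ (A B : Subgroup U) [A.Normal] [B.Normal], IsChiefFactor A B →
      (∃ k : ℕ, B.relIndex A = p ^ k) → K ≤ factorCentralizer A B) :
    ∃ N : Subgroup U, N.Normal ∧ N ≤ K ∧ (Nat.card N).Coprime p ∧ ∃ k, N.relIndex K = p ^ k := by
  obtain ⟨N, hN, -, hNK, hc, hk⟩ :=
    exists_normal_complement_aux hp K hK ⊥ inferInstance bot_le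
  exact ⟨N, hN, hNK, by simpa using hc, hk⟩

/-! ### The residual and characteristic subgroups -/

/-- The residual: a least normal subgroup whose quotient lies in the formation. -/
theorem IsFormation.exists_residual {X : GroupClass.{u}} (hX : IsFormation X)
    {U : Type u} [Group U] [Finite U] (h : ∃ (L : Subgroup U) (_ : L.Normal), X (U ⧸ L)) :
    ∃ K : Subgroup U, K.Characteristic ∧
      ∀ (L : Subgroup U) [L.Normal], X (U ⧸ L) ↔ K ≤ L := by
  obtain ⟨K, hK⟩ := (Set.toFinite {L : Subgroup U | ∃ _ : L.Normal, X (U ⧸ L)}).exists_minimal h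
  obtain ⟨⟨hKn, hKX⟩, hmin⟩ := hK
  have key : ∀ (L : Subgroup U) [L.Normal], X (U ⧸ L) ↔ K ≤ L := by
    intro L hL
    refine ⟨fun h => ?_, fun h => ?_⟩
    · exact (hmin (y := K ⊓ L) ⟨inferInstance, hX.inf U K L hKX h⟩ inf_le_left).trans inf_le_right
    · have := hX.quotient (U ⧸ K) (L.map (QuotientGroup.mk' K)) hKX
      exact hX.iso _ _ (QuotientGroup.quotientQuotientEquivQuotient K L h) this
  refine ⟨K, Subgroup.characteristic_iff_le_comap.2 fun φ => ?_, key⟩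
  -- `U ⧸ φ⁻¹(K)` is isomorphic to `U ⧸ K`, so it lies in the formation and `K ≤ φ⁻¹(K)`.
  refine (key _).1 (hX.iso _ _ (QuotientGroup.congr _ K φ ?_).symm hKX)
  exact Subgroup.map_comap_eq_self_of_surjective φ.surjective K

/-- Since `K/N` has `p`-power order and `|N|` is prime to `p`, `N` is the set of solutions of `x ^
|N| = 1` in `K`, a description that automorphisms preserve. -/
theorem characteristic_of_coprime_of_relIndex {U : Type u} [Group U] [Finite U] {p : ℕ}
    {K N : Subgroup U} (hK : K.Characteristic) [N.Normal] (hNK : N ≤ K)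
    (hc : (Nat.card N).Coprime p) {k : ℕ} (hk : N.relIndex K = p ^ k) : N.Characteristic := by
  have hmem : ∀ x, x ∈ N ↔ x ∈ K ∧ x ^ Nat.card N = 1 := by
    intro x
    refine ⟨fun hx => ⟨hNK hx, N.pow_card_eq_one_of_mem hx⟩, fun ⟨hxK, hx⟩ => ?_⟩
    · have h1 : (QuotientGroup.mk' (N.subgroupOf K) ⟨x, hxK⟩) ^ Nat.card N = 1 := by
        rw [← map_pow, show (⟨x, hxK⟩ : K) ^ Nat.card N = 1 from Subtype.ext hx, map_one]
      have h2 : (QuotientGroup.mk' (N.subgroupOf K) ⟨x, hxK⟩) ^ (p ^ k) = 1 := by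
        rw [← hk]; exact pow_card_eq_one'
      have := Nat.dvd_gcd (orderOf_dvd_of_pow_eq_one h1) (orderOf_dvd_of_pow_eq_one h2)
      rw [(Nat.Coprime.pow_right k hc)] at this
      have := orderOf_eq_one_iff.1 (Nat.dvd_one.1 this)
      simpa [Subgroup.mem_subgroupOf] using this
  refine Subgroup.characteristic_iff_le_comap.2 fun φ x hx => ?_
  obtain ⟨h1, h2⟩ := (hmem x).1 hx
  refine (hmem _).2 ⟨Subgroup.characteristic_iff_le_comap.1 hK φ h1, ?_⟩
  change (φ x) ^ _ = 1
  rw [← map_pow, h2, map_one]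

/-! ### Fixed vectors of `p`-groups and irreducible submodules -/

section Modules

variable {F : Type w} [Field F] {U : Type u} [Group U] {W : Type v} [AddCommGroup W] [Module F W]

theorem mem_ker_factorRep {τ : Representation F U W} {A B : Subrepresentation τ} {u : U} :
    u ∈ MonoidHom.ker (factorRep A B) ↔
      ∀ b ∈ B.toSubmodule, τ u b - b ∈ A.toSubmodule := by
  rw [MonoidHom.mem_ker]
  constructor
  · intro h b hb
    have h1 := LinearMap.congr_fun h (Submodule.Quotient.mk ⟨b, hb⟩)
    exact (Submodule.Quotient.eq (A.toSubmodule.comap B.toSubmodule.subtype)).1 h1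
  · intro h
    ext ⟨b, hb⟩
    exact (Submodule.Quotient.eq (A.toSubmodule.comap B.toSubmodule.subtype)).2 (h b hb)

/-- A finite `p`-group acting on a nonzero module in characteristic `p` has a nonzero fixed
vector. -/
theorem IsPGroup.exists_ne_zero_fixed {p : ℕ} [hp : Fact p.Prime] [CharP F p] [Finite U]
    (hU : IsPGroup p U) (τ : Representation F U W) {y : W} (hy : y ≠ 0) :
    ∃ x : W, x ≠ 0 ∧ ∀ u, τ u x = x := by
  -- The additive group, not the `F`-span, generated by the orbit: it is finite even if `F` is
  -- infinite, so orbits can be counted in it.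
  let S : AddSubgroup W := AddSubgroup.closure (Set.range fun g => τ g y)
  have hpS : ∀ x : W, p • x = 0 := fun x => by
    rw [← Nat.cast_smul_eq_nsmul F, CharP.cast_eq_zero, zero_smul]
  have hfg : AddGroup.FG S := (AddGroup.fg_iff_addSubgroup_fg S).2
    ⟨(Set.finite_range fun g => τ g y).toFinset, by rw [Set.Finite.coe_toFinset]⟩
  have hfin : Finite S := AddCommGroup.finite_of_fg_isAddTorsion S fun x =>
    isOfFinAddOrder_iff_nsmul_eq_zero.2 ⟨p, hp.1.pos, Subtype.ext (hpS x)⟩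
  have hS : ∀ g, ∀ x ∈ S, τ g x ∈ S := by
    intro g x hx
    induction hx using AddSubgroup.closure_induction with
    | mem x hx =>
      obtain ⟨h, rfl⟩ := hx
      exact AddSubgroup.subset_closure ⟨g * h, by simp [map_mul]⟩
    | zero => rw [map_zero]; exact S.zero_mem
    | add a b _ _ ha hb => rw [map_add]; exact S.add_mem ha hb
    | neg a _ ha => rw [map_neg]; exact S.neg_mem ha
  let act : MulAction U S :=
    { smul := fun g x => ⟨τ g x, hS g x x.2⟩
      one_smul := fun x => Subtype.ext (LinearMap.congr_fun (map_one τ) (x : W))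
      mul_smul := fun g h x => Subtype.ext (LinearMap.congr_fun (map_mul τ g h) (x : W)) }
  have hyS : y ∈ S := AddSubgroup.subset_closure ⟨1, by simp⟩
  have hdvd : p ∣ Nat.card S := by
    have h1 : addOrderOf (⟨y, hyS⟩ : S) = p :=
      addOrderOf_eq_prime (Subtype.ext (hpS y)) fun h => hy (congrArg Subtype.val h)
    exact h1 ▸ addOrderOf_dvd_natCard _
  obtain ⟨b, hb, hb0⟩ := hU.exists_fixed_point_of_prime_dvd_card_of_fixed_point S hdvd
    (a := 0) fun g => Subtype.ext (map_zero (τ g))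
  exact ⟨b, fun h => hb0 (Subtype.ext h.symm), fun u => congrArg Subtype.val (hb u)⟩

theorem exists_ne_zero_fixed {p : ℕ} [Fact p.Prime] [CharP F p] [Finite U]
    (τ : Representation F U W) (hτ : ∀ u : U, ∃ k : ℕ, u ^ p ^ k ∈ MonoidHom.ker τ)
    {y : W} (hy : y ≠ 0) : ∃ x : W, x ≠ 0 ∧ ∀ u, τ u x = x := by
  have hP : IsPGroup p (U ⧸ MonoidHom.ker τ) := by
    intro x
    obtain ⟨u, rfl⟩ := QuotientGroup.mk'_surjective _ x
    obtain ⟨k, hk⟩ := hτ u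
    exact ⟨k, by rw [← map_pow]; exact (QuotientGroup.eq_one_iff _).2 hk⟩
  obtain ⟨x, hx0, hx⟩ := hP.exists_ne_zero_fixed
    (QuotientGroup.lift (MonoidHom.ker τ) τ fun _ h => h) hy
  exact ⟨x, hx0, fun u => hx (QuotientGroup.mk' _ u)⟩

theorem exists_bot_covBy_of_finite {τ : Representation F U W} (D : Subrepresentation τ)
    [FiniteDimensional F D.toSubmodule] (hD : D ≠ ⊥) : ∃ B ≤ D, ⊥ ⋖ B := by
  induction h : Module.finrank F D.toSubmodule using Nat.strong_induction_on generalizing D with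
  | _ n ih =>
  by_cases hc : ⊥ ⋖ D
  · exact ⟨D, le_rfl, hc⟩
  obtain ⟨C, hC0, hCD⟩ := exists_lt_lt_of_not_covBy (bot_lt_iff_ne_bot.2 hD) hc
  have hlt : C.toSubmodule < D.toSubmodule := hCD
  have := Submodule.finiteDimensional_of_le hlt.le
  obtain ⟨B, hB, hB'⟩ := ih _ (h ▸ Submodule.finrank_lt_finrank_of_lt hlt) C hC0.ne' rfl
  exact ⟨B, hB.trans hCD.le, hB'⟩

/-- The orbit of `y` is finite and spans a finite-dimensional submodule. This is what allows modules
of infinite dimension. -/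
theorem exists_bot_covBy [Finite U] {τ : Representation F U W} (D : Subrepresentation τ)
    {y : W} (hy : y ∈ D.toSubmodule) (hy0 : y ≠ 0) : ∃ B ≤ D, ⊥ ⋖ B := by
  let E : Subrepresentation τ :=
    { toSubmodule := Submodule.span F (Set.range fun u => τ u y)
      apply_mem_toSubmodule := fun g x hx => by
        induction hx using Submodule.span_induction with
        | mem x hx =>
          obtain ⟨h, rfl⟩ := hx
          exact Submodule.subset_span ⟨g * h, by simp [map_mul]⟩
        | zero => simp
        | add a b _ _ ha hb => rw [map_add]; exact Submodule.add_mem _ ha hb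
        | smul c a _ ha => rw [map_smul]; exact Submodule.smul_mem _ c ha }
  have : FiniteDimensional F E.toSubmodule :=
    FiniteDimensional.span_of_finite F (Set.finite_range _)
  have hyE : y ∈ E.toSubmodule := Submodule.subset_span ⟨1, by simp⟩
  have hE : E ≠ ⊥ := by
    intro h
    rw [h] at hyE
    exact hy0 ((Submodule.mem_bot F).1 hyE)
  obtain ⟨B, hB, hB'⟩ := exists_bot_covBy_of_finite E hE
  refine ⟨B, hB.trans ?_, hB'⟩
  change Submodule.span F _ ≤ D.toSubmodule
  rw [Submodule.span_le]
  rintro _ ⟨u, rfl⟩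
  exact D.apply_mem_toSubmodule u hy

/-- If the normal subgroup `K` acts on the irreducible factor `B / A` through a `p`-group, it acts
trivially. -/
theorem smul_sub_mem_of_covBy {p : ℕ} [Fact p.Prime] [CharP F p] [Finite U]
    {τ : Representation F U W} {A B : Subrepresentation τ} (hAB : A ⋖ B)
    (K : Subgroup U) [K.Normal]
    (hK : ∀ x ∈ K, ∃ k : ℕ, ∀ b ∈ B.toSubmodule, τ (x ^ p ^ k) b - b ∈ A.toSubmodule) :
    ∀ x ∈ K, ∀ b ∈ B.toSubmodule, τ x b - b ∈ A.toSubmodule := by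
  -- The preimage in `B` of the `K`-fixed vectors of `B/A`. It is `U`-stable as `K` is normal, and
  -- larger than `A`, so it equals `B`.
  let C : Subrepresentation τ :=
    { toSubmodule :=
        { carrier := {b | b ∈ B.toSubmodule ∧ ∀ x ∈ K, τ x b - b ∈ A.toSubmodule}
          zero_mem' := ⟨B.toSubmodule.zero_mem, fun x _ => by simp⟩
          add_mem' := fun {a b} ha hb => ⟨B.toSubmodule.add_mem ha.1 hb.1, fun x hx => by
            rw [map_add, add_sub_add_comm]
            exact A.toSubmodule.add_mem (ha.2 x hx) (hb.2 x hx)⟩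
          smul_mem' := fun c a ha => ⟨B.toSubmodule.smul_mem c ha.1, fun x hx => by
            rw [map_smul, ← smul_sub]
            exact A.toSubmodule.smul_mem c (ha.2 x hx)⟩ }
      apply_mem_toSubmodule := fun u b hb => ⟨B.apply_mem_toSubmodule u hb.1, fun x hx => by
        have h1 : τ x (τ u b) - τ u b = τ u (τ (u⁻¹ * x * u) b - b) := by
          simp only [map_sub, ← Module.End.mul_apply, ← map_mul]
          congr 3
          group
        rw [h1]
        refine A.apply_mem_toSubmodule u (hb.2 _ ?_)
        simpa using Subgroup.Normal.conj_mem ‹K.Normal› x hx u⁻¹⟩ }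
  have hAC : A ≤ C := fun b hb => ⟨hAB.le hb, fun x _ =>
    A.toSubmodule.sub_mem (A.apply_mem_toSubmodule x hb) hb⟩
  have hCB : C ≤ B := fun b hb => hb.1
  have hne : ¬ C ≤ A := by
    obtain ⟨b, hbB, hbA⟩ := SetLike.exists_of_lt hAB.lt
    obtain ⟨y, hy0, hy⟩ := exists_ne_zero_fixed (p := p)
      (restrictTo (factorRep A B) K) (by
        intro x
        obtain ⟨k, hk⟩ := hK x x.2
        refine ⟨k, ?_⟩
        rw [MonoidHom.mem_ker, MonoidHom.comp_apply, map_pow, Subgroup.subtype_apply]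
        exact mem_ker_factorRep.2 hk)
      (y := Submodule.Quotient.mk ⟨b, hbB⟩) (fun h => hbA ((Submodule.Quotient.mk_eq_zero (A.toSubmodule.comap B.toSubmodule.subtype)).1 h))
    obtain ⟨c, rfl⟩ := Submodule.Quotient.mk_surjective _ y
    intro h
    refine hy0 ((Submodule.Quotient.mk_eq_zero (A.toSubmodule.comap B.toSubmodule.subtype)).2 (h (x := (c : W)) ⟨c.2, fun x hx => ?_⟩))
    exact (Submodule.Quotient.eq (A.toSubmodule.comap B.toSubmodule.subtype)).1 (hy ⟨x, hx⟩)
  rcases hAB.eq_or_eq hAC hCB with h | h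
  · exact absurd h.le hne
  · exact fun x hx b hb => (h.ge hb).2 x hx

/-! ### The operator `∑ n` over a subgroup `N` -/

/-- The sum of the elements of the subgroup `N` as an endomorphism of the module. -/
noncomputable def subgroupSum [Finite U] (τ : Representation F U W) (N : Subgroup U) : W →ₗ[F] W :=
  ∑ n ∈ (Set.toFinite (N : Set U)).toFinset, τ n

variable [Finite U]

theorem subgroupSum_apply (τ : Representation F U W) (N : Subgroup U) (x : W) :
    subgroupSum τ N x = ∑ n ∈ (Set.toFinite (N : Set U)).toFinset, τ n x := by
  simp [subgroupSum]

theorem apply_subgroupSum (τ : Representation F U W) (N : Subgroup U) {m : U} (hm : m ∈ N) (x : W) :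
    τ m (subgroupSum τ N x) = subgroupSum τ N x := by
  rw [subgroupSum_apply, map_sum]
  refine Finset.sum_equiv (Equiv.mulLeft m) (fun n => ?_) fun n _ => ?_
  · simp [Subgroup.mul_mem_cancel_left N hm]
  · simp [map_mul]

theorem subgroupSum_sub_mem (τ : Representation F U W) (N : Subgroup U) (A : Submodule F W) {x : W}
    (hx : ∀ n ∈ N, τ n x - x ∈ A) : subgroupSum τ N x - Nat.card N • x ∈ A := by
  have h1 : Nat.card N • x = ∑ n ∈ (Set.toFinite (N : Set U)).toFinset, x := by
    rw [Finset.sum_const, ← Set.ncard_eq_toFinset_card]; rfl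
  rw [subgroupSum_apply, h1, ← Finset.sum_sub_distrib]
  exact A.sum_mem fun n hn => hx n (by simpa using hn)

theorem subgroupSum_of_fixed (τ : Representation F U W) (N : Subgroup U) {x : W}
    (hx : ∀ n ∈ N, τ n x = x) : subgroupSum τ N x = Nat.card N • x := by
  have := subgroupSum_sub_mem τ N ⊥ (x := x) fun n hn => by simp [hx n hn]
  exact sub_eq_zero.1 ((Submodule.mem_bot F).1 this)

/-- An automorphism permutes the elements of `N`. Allowing a twist by any `φ` covers both the action
of `U` itself and that of a group in which `U` is normal. -/
theorem subgroupSum_comm (τ : Representation F U W) (N : Subgroup U) (hN : N.Characteristic)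
    (φ : U ≃* U) (T : W →ₗ[F] W) (hT : ∀ n x, τ (φ n) (T x) = T (τ n x)) (x : W) :
    subgroupSum τ N (T x) = T (subgroupSum τ N x) := by
  rw [subgroupSum_apply, subgroupSum_apply, map_sum]
  refine (Finset.sum_equiv φ.toEquiv (fun n => ?_) fun n _ => (hT n x).symm).symm
  have := Subgroup.characteristic_iff_comap_eq.1 hN φ
  simp only [Set.Finite.mem_toFinset, SetLike.mem_coe]
  conv_lhs => rw [← this]
  rfl

theorem natCast_ne_zero_of_coprime {p : ℕ} [hp : Fact p.Prime] [CharP F p] {m : ℕ}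
    (h : m.Coprime p) : (m : F) ≠ 0 := by
  rw [Ne, CharP.cast_eq_zero_iff F p]
  exact fun hd => hp.1.one_lt.ne' (Nat.eq_one_of_dvd_coprimes h hd dvd_rfl)

theorem nsmul_mem_iff_of_coprime {p : ℕ} [Fact p.Prime] [CharP F p] {m : ℕ} (h : m.Coprime p)
    (A : Submodule F W) {x : W} : m • x ∈ A ↔ x ∈ A := by
  rw [← Nat.cast_smul_eq_nsmul F]
  exact A.smul_mem_iff (natCast_ne_zero_of_coprime h)

theorem subgroupSum_conj (τ : Representation F U W) (N : Subgroup U) (hN : N.Characteristic)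
    (u : U) (x : W) : subgroupSum τ N (τ u x) = τ u (subgroupSum τ N x) :=
  subgroupSum_comm τ N hN (MulAut.conj u) (τ u) (fun n x => by
    simp only [← Module.End.mul_apply, ← map_mul, MulAut.conj_apply]
    congr 2; group) x

/-- The vectors annihilated by the sum of `N`. -/
noncomputable def sumKer (τ : Representation F U W) (N : Subgroup U) (hN : N.Characteristic) :
    Subrepresentation τ where
  toSubmodule := LinearMap.ker (subgroupSum τ N)
  apply_mem_toSubmodule u x hx := by
    rw [LinearMap.mem_ker] at hx ⊢
    rw [subgroupSum_conj τ N hN, hx, map_zero]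

omit [Finite U] in
theorem fixed_conj (τ : Representation F U W) (N : Subgroup U) (hN : N.Characteristic)
    (φ : U ≃* U) (T : W →ₗ[F] W) (hT : ∀ n x, τ (φ n) (T x) = T (τ n x)) {x : W}
    (hx : ∀ n ∈ N, τ n x = x) : ∀ n ∈ N, τ n (T x) = T x := by
  intro n hn
  have h1 : φ.symm n ∈ N := Subgroup.characteristic_iff_le_comap.1 hN φ.symm hn
  have h2 := hT (φ.symm n) x
  rwa [MulEquiv.apply_symm_apply, hx _ h1] at h2

/-- The vectors fixed by `N`. -/
def fixedBy (τ : Representation F U W) (N : Subgroup U) (hN : N.Characteristic) :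
    Subrepresentation τ where
  toSubmodule :=
    { carrier := {x | ∀ n ∈ N, τ n x = x}
      zero_mem' := fun n _ => map_zero _
      add_mem' := fun {a b} ha hb n hn => by rw [map_add, ha n hn, hb n hn]
      smul_mem' := fun c a ha n hn => by rw [map_smul, ha n hn] }
  apply_mem_toSubmodule u x hx := fixed_conj τ N hN (MulAut.conj u) (τ u) (fun n x => by
    simp only [← Module.End.mul_apply, ← map_mul, MulAut.conj_apply]
    congr 2; group) hx

/-! ### Central and eccentric factors read off from `N` -/

variable {f : Nat.Primes → GroupClass.{u}} {p : Nat.Primes} [CharP F p] {K N : Subgroup U}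

omit [Finite U] [CharP F p] in
theorem isCentralModule_factorRep_iff (hK : ∀ (L : Subgroup U) [L.Normal], f p (U ⧸ L) ↔ K ≤ L)
    {τ : Representation F U W} (A B : Subrepresentation τ) :
    IsCentralModule f p (factorRep A B) ↔
      ∀ x ∈ K, ∀ b ∈ B.toSubmodule, τ x b - b ∈ A.toSubmodule := by
  rw [IsCentralModule, hK]
  exact ⟨fun h x hx => mem_ker_factorRep.1 (h hx), fun h x hx => mem_ker_factorRep.2 (h x hx)⟩

variable (hK : ∀ (L : Subgroup U) [L.Normal], f p (U ⧸ L) ↔ K ≤ L) [K.Normal] (hNK : N ≤ K)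
  (hN : N.Characteristic) (hc : (Nat.card N).Coprime p) {k : ℕ} (hk : N.relIndex K = p ^ k)

-- `K` acts on `B/A` through the `p`-group `K/N`, hence trivially by irreducibility.
include hK hk hN in
theorem isCentralModule_of_fixed {τ : Representation F U W} {A B : Subrepresentation τ}
    (hAB : A ⋖ B) (h : ∀ n ∈ N, ∀ b ∈ B.toSubmodule, τ n b - b ∈ A.toSubmodule) :
    IsCentralModule f p (factorRep A B) := by
  have := Fact.mk p.2
  rw [isCentralModule_factorRep_iff hK]
  refine smul_sub_mem_of_covBy (p := p) hAB K fun x hx => ⟨k, h _ ?_⟩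
  have : (QuotientGroup.mk' (N.subgroupOf K) ⟨x, hx⟩) ^ ((p : ℕ) ^ k) = 1 := by
    rw [← hk]; exact pow_card_eq_one'
  rw [← map_pow] at this
  exact Subgroup.mem_subgroupOf.1 ((QuotientGroup.eq_one_iff _).1 this)

-- On a central factor `N` acts trivially, so its sum acts as the nonzero scalar `|N|` and cannot
-- vanish.
omit [K.Normal] in
include hK hNK hc in
theorem not_isCentralModule_of_subgroupSum {τ : Representation F U W} {A B : Subrepresentation τ}
    (hAB : A ⋖ B) (h : ∀ b ∈ B.toSubmodule, subgroupSum τ N b ∈ A.toSubmodule) :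
    ¬ IsCentralModule f p (factorRep A B) := by
  have := Fact.mk p.2
  rw [isCentralModule_factorRep_iff hK]
  intro h1
  refine hAB.lt.not_ge fun b hb => ?_
  have h2 := subgroupSum_sub_mem τ N A.toSubmodule fun n hn => h1 n (hNK hn) b hb
  refine (nsmul_mem_iff_of_coprime (F := F) hc A.toSubmodule).1 ?_
  simpa using A.toSubmodule.sub_mem (h b hb) h2

include hK hNK hc hN hk

theorem isHypercentral_iff (τ : Representation F U W) :
    IsHypercentral f p τ ↔ ∀ n ∈ N, ∀ x, τ n x = x := by
  have := Fact.mk p.2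
  constructor
  · intro h n hn x
    by_contra hne
    -- This vector is nonzero when `N` moves `x`, and the sum kills it; an irreducible submodule of
    -- the kernel would be an eccentric factor.
    have hy : Nat.card N • x - subgroupSum τ N x ∈ (sumKer τ N hN).toSubmodule := by
      change subgroupSum τ N _ = 0
      rw [map_sub, map_nsmul, subgroupSum_of_fixed τ N fun n hn => apply_subgroupSum τ N hn x,
        sub_self]
    obtain ⟨B, hB, hB'⟩ := exists_bot_covBy (sumKer τ N hN) hy fun h0 => hne (by
      have h1 : τ n (Nat.card N • x) = Nat.card N • x := by
        rw [sub_eq_zero.1 h0, apply_subgroupSum τ N hn]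
      rw [map_nsmul] at h1
      have h2 : Nat.card N • (τ n x - x) ∈ (⊥ : Submodule F W) := by
        rw [smul_sub, h1, sub_self]; exact Submodule.zero_mem _
      exact sub_eq_zero.1 ((Submodule.mem_bot F).1 ((nsmul_mem_iff_of_coprime hc _).1 h2)))
    exact not_isCentralModule_of_subgroupSum hK hNK hc hB' (fun b hb => hB hb) (h _ _ hB')
  · intro h A B hAB
    exact isCentralModule_of_fixed hK hN hk hAB fun n hn b _ => by simp [h n hn]

theorem isHypereccentric_iff (τ : Representation F U W) :
    IsHypereccentric f p τ ↔ ∀ x, subgroupSum τ N x = 0 := by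
  constructor
  · intro h x
    by_contra hne
    -- A nonzero value of the sum is fixed by `N`, so the fixed vectors contain an irreducible
    -- submodule, which is central.
    obtain ⟨B, hB, hB'⟩ := exists_bot_covBy (fixedBy τ N hN) (y := subgroupSum τ N x)
      (fun n hn => apply_subgroupSum τ N hn x) hne
    refine h _ _ hB' (isCentralModule_of_fixed hK hN hk hB' fun n hn b hb => ?_)
    rw [hB hb n hn, sub_self]
    exact Submodule.zero_mem _
  · intro h A B hAB
    exact not_isCentralModule_of_subgroupSum hK hNK hc hAB fun b _ => by
      rw [h]; exact Submodule.zero_mem _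

end Modules

/-! ### Existence, uniqueness and stability of the components -/

section Components

variable {F : Type w} [Field F] {U : Type u} [Group U] [Finite U] {W : Type v} [AddCommGroup W]
  [Module F W]

theorem coe_subgroupSum_toRepresentation {σ : Representation F U W} (P : Subrepresentation σ)
    (N : Subgroup U) (x : P.toSubmodule) :
    (subgroupSum P.toRepresentation N x : W) = subgroupSum σ N x := by
  rw [subgroupSum_apply, subgroupSum_apply, Submodule.coe_sum]
  rfl

omit [Finite U] in
theorem isCompl_iff_toSubmodule {σ : Representation F U W} {P M : Subrepresentation σ} :
    IsCompl P M ↔ IsCompl P.toSubmodule M.toSubmodule := by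
  simp only [isCompl_iff, disjoint_iff, codisjoint_iff,
    ← Subrepresentation.toSubmodule_injective.eq_iff]
  rfl

theorem isCompl_fixedBy_sumKer {p : ℕ} [Fact p.Prime] [CharP F p] (σ : Representation F U W)
    {N : Subgroup U} (hN : N.Characteristic) (hc : (Nat.card N).Coprime p) :
    IsCompl (fixedBy σ N hN) (sumKer σ N hN) := by
  rw [isCompl_iff_toSubmodule, isCompl_iff, Submodule.disjoint_def, codisjoint_iff,
    Submodule.eq_top_iff']
  have h0 : (Nat.card N : F) ≠ 0 := natCast_ne_zero_of_coprime hc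
  refine ⟨fun x hx hx' => ?_, fun x => ?_⟩
  · have h1 := subgroupSum_of_fixed σ N hx
    rw [LinearMap.mem_ker.1 hx', ← Nat.cast_smul_eq_nsmul F] at h1
    exact (smul_eq_zero.1 h1.symm).resolve_left h0
  · rw [← Submodule.smul_mem_iff _ h0, Nat.cast_smul_eq_nsmul,
      ← add_sub_cancel (subgroupSum σ N x) (Nat.card N • x)]
    refine Submodule.add_mem_sup (fun n hn => apply_subgroupSum σ N hn x) (LinearMap.mem_ker.2 ?_)
    rw [map_sub, map_nsmul, subgroupSum_of_fixed σ N fun n hn => apply_subgroupSum σ N hn x,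
      sub_self]

-- Modularity of the submodule lattice. It reduces uniqueness of the components to two inclusions.
omit [Finite U] in
theorem IsCompl.eq_of_le_subrepresentation {σ : Representation F U W}
    {P M P' M' : Subrepresentation σ} (h : IsCompl P M) (h' : IsCompl P' M')
    (hP : P ≤ P') (hM : M ≤ M') : P = P' ∧ M = M' := by
  rw [isCompl_iff_toSubmodule] at h h'
  have hP : P.toSubmodule ≤ P'.toSubmodule := hP
  have hM : M.toSubmodule ≤ M'.toSubmodule := hM
  constructor
  · exact Subrepresentation.toSubmodule_injective (eq_of_le_of_inf_le_of_sup_le hP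
      (z := M.toSubmodule) (by rw [(h'.disjoint.mono_right hM).eq_bot]; exact bot_le)
      (by rw [h.sup_eq_top]; exact le_top))
  · exact Subrepresentation.toSubmodule_injective (eq_of_le_of_inf_le_of_sup_le hM
      (z := P.toSubmodule) (by rw [(h'.symm.disjoint.mono_right hP).eq_bot]; exact bot_le)
      (by rw [h.symm.sup_eq_top]; exact le_top))

variable {f : Nat.Primes → GroupClass.{u}} {p : Nat.Primes}

theorem IsHypercentral.subsingleton {τ : Representation F U W}
    (hf : ¬ ∃ (L : Subgroup U) (_ : L.Normal), f p (U ⧸ L)) (h : IsHypercentral f p τ) (x : W) :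
    x = 0 := by
  by_contra hx
  obtain ⟨B, -, hB⟩ := exists_bot_covBy (τ := τ) ⊤ (y := x) trivial hx
  exact hf ⟨_, inferInstance, h _ _ hB⟩

theorem exists_components_of_not_exists (σ : Representation F U W)
    (hf : ¬ ∃ (L : Subgroup U) (_ : L.Normal), f p (U ⧸ L)) :
    AreComponents f p (⊥ : Subrepresentation σ) ⊤ ∧
      ∀ P M : Subrepresentation σ, AreComponents f p P M → P = ⊥ ∧ M = ⊤ := by
  refine ⟨⟨isCompl_bot_top, fun A B hAB => ?_, fun A B _ h => hf ⟨_, inferInstance, h⟩⟩,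
    fun P M h => ?_⟩
  · refine absurd (fun b _ => ?_) hAB.lt.not_ge
    have : b = 0 := Subtype.ext ((Submodule.mem_bot F).1 b.2)
    rw [this]
    exact A.toSubmodule.zero_mem
  · refine h.isCompl.eq_of_le_subrepresentation isCompl_bot_top (fun x hx => ?_) le_top
    exact (Submodule.mem_bot F).2
      (congrArg Subtype.val (h.hypercentral.subsingleton hf (⟨x, hx⟩ : P.toSubmodule)))

theorem areComponents_fixedBy_sumKer [CharP F p] {K N : Subgroup U}
    (hK : ∀ (L : Subgroup U) [L.Normal], f p (U ⧸ L) ↔ K ≤ L) [K.Normal] (hNK : N ≤ K)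
    (hN : N.Characteristic) (hc : (Nat.card N).Coprime p) {k : ℕ} (hk : N.relIndex K = p ^ k)
    (σ : Representation F U W) :
    AreComponents f p (fixedBy σ N hN) (sumKer σ N hN) ∧
      ∀ P M : Subrepresentation σ, AreComponents f p P M →
        P = fixedBy σ N hN ∧ M = sumKer σ N hN := by
  have := Fact.mk p.2
  refine ⟨⟨isCompl_fixedBy_sumKer σ hN hc, ?_, ?_⟩, fun P M h => ?_⟩
  · rw [isHypercentral_iff hK hNK hN hc hk]
    exact fun n hn x => Subtype.ext (x.2 n hn)
  · rw [isHypereccentric_iff hK hNK hN hc hk]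
    exact fun x => Subtype.ext ((coe_subgroupSum_toRepresentation _ N x).trans x.2)
  · refine h.isCompl.eq_of_le_subrepresentation (isCompl_fixedBy_sumKer σ hN hc) ?_ ?_
    · intro x hx n hn
      exact congrArg Subtype.val ((isHypercentral_iff hK hNK hN hc hk _).1 h.hypercentral n hn
        (⟨x, hx⟩ : P.toSubmodule))
    · intro x hx
      have h1 := (isHypereccentric_iff hK hNK hN hc hk _).1 h.hypereccentric
        (⟨x, hx⟩ : M.toSubmodule)
      exact (coe_subgroupSum_toRepresentation M N ⟨x, hx⟩).symm.trans (congrArg Subtype.val h1)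

end Components

theorem exists_stable_components {X : GroupClass.{u}} {f : Nat.Primes → GroupClass.{u}}
    (hX : IsIntegratedLocalDefinition X f) (p : Nat.Primes) {F : Type w} [Field F] [CharP F p]
    {G : Type u} [Group G] [Finite G] (U : Subgroup G) [hU : U.Normal] (hXU : X U)
    {V : Type v} [AddCommGroup V] [Module F V] (ρ : Representation F G V) :
    ∃ P₀ M₀ : Subrepresentation (restrictTo ρ U), AreComponents f p P₀ M₀ ∧
      (IsStableUnder ρ P₀.toSubmodule ∧ IsStableUnder ρ M₀.toSubmodule) ∧
      ∀ P M, AreComponents f p P M → P = P₀ ∧ M = M₀ := by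
  by_cases hf : ∃ (L : Subgroup U) (_ : L.Normal), f p (U ⧸ L)
  · obtain ⟨K, hKc, hK⟩ := (hX.formation p).exists_residual hf
    obtain ⟨-, hsol, hloc⟩ := (hX.eq_loc U).1 hXU
    -- `U ⧸ C_U(A/B) ∈ f(p)` says exactly that `K` centralises `A/B`.
    obtain ⟨N, hNn, hNK, hc, k, hk⟩ := exists_normal_complement p.2 K fun A B _ _ hAB hpow =>
      (hK _).1 (hloc p A B hAB hpow)
    have hN := characteristic_of_coprime_of_relIndex hKc hNK hc hk
    -- `ρ g` intertwines the action of `U` with its twist by conjugation by `g`, an automorphism of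
    -- `U` that preserves `N`.
    have hconj : ∀ (g : G) (n : U) (x : V),
        restrictTo ρ U (MulAut.conjNormal g n) (ρ g x) = ρ g (restrictTo ρ U n x) := by
      intro g n x
      change ρ (MulAut.conjNormal g n : U) (ρ g x) = ρ g (ρ n x)
      rw [MulAut.conjNormal_apply]
      simp only [← Module.End.mul_apply, ← map_mul]
      congr 2
      group
    obtain ⟨h1, h2⟩ := areComponents_fixedBy_sumKer hK hNK hN hc hk (restrictTo ρ U)
    refine ⟨_, _, h1, ⟨fun g x hx => ?_, fun g x hx => ?_⟩, h2⟩
    · exact fixed_conj _ N hN (MulAut.conjNormal g) (ρ g) (hconj g) hx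
    · refine (subgroupSum_comm _ N hN (MulAut.conjNormal g) (ρ g) (hconj g) x).trans ?_
      rw [LinearMap.mem_ker.1 hx, map_zero]
  · obtain ⟨h1, h2⟩ := exists_components_of_not_exists (restrictTo ρ U) hf
    refine ⟨_, _, h1, ⟨fun g x hx => ?_, fun g x hx => Submodule.mem_top⟩, h2⟩
    refine (Submodule.mem_bot F).2 ?_
    rw [(Submodule.mem_bot F).1 hx, map_zero]

/-! ### Nilpotent groups as a locally defined formation -/

theorem subsingleton_quotient_iff {G : Type u} [Group G] (N : Subgroup G) :
    Subsingleton (G ⧸ N) ↔ N = ⊤ :=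
  ⟨QuotientGroup.subgroup_eq_top_of_subsingleton N, fun h =>
    h ▸ QuotientGroup.subsingleton_quotient_top⟩

theorem isFormation_trivialFormation (p : Nat.Primes) :
    IsFormation (trivialFormation.{u} p) where
  finite G _ h := by
    have : Subsingleton G := h
    infer_instance
  iso G H _ _ e h := by
    have : Subsingleton G := h
    exact e.symm.injective.subsingleton
  quotient G _ N _ h := by
    have : Subsingleton G := h
    exact (QuotientGroup.mk'_surjective N).subsingleton
  inf G _ _ M N _ _ hM hN := by
    rw [trivialFormation, subsingleton_quotient_iff] at *
    rw [hM, hN, inf_top_eq]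

theorem isSaturatedFormation_finiteNilpotent : IsSaturatedFormation FiniteNilpotent.{u} where
  finite G _ h := h.1
  iso G H _ _ e h := by
    have := h.1
    have := h.2
    exact ⟨Finite.of_equiv G e.toEquiv, Group.nilpotent_of_mulEquiv e⟩
  quotient G _ N _ h := by
    have := h.1
    have := h.2
    exact ⟨inferInstance, inferInstance⟩
  inf G _ _ M N _ _ hM hN := by
    have := hM.2
    have := hN.2
    refine ⟨inferInstance, ?_⟩
    let φ : G →* (G ⧸ M) × (G ⧸ N) := (QuotientGroup.mk' M).prod (QuotientGroup.mk' N)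
    have hφ : φ.ker = M ⊓ N := by
      ext x; simp [φ, MonoidHom.mem_ker, Prod.ext_iff, Subgroup.mem_inf]
    have h1 : Group.IsNilpotent (G ⧸ φ.ker) :=
      Group.nilpotent_of_mulEquiv (QuotientGroup.quotientKerEquivRange φ).symm
    exact Group.nilpotent_of_mulEquiv (QuotientGroup.quotientMulEquivOfEq hφ)
  saturated G _ _ h := by
    have := h.2
    -- Finite nilpotency means that all maximal subgroups are normal, and every maximal subgroup
    -- contains the Frattini subgroup.
    refine ⟨inferInstance, ((Group.isNilpotent_of_finite_tfae (G := G)).out 0 2).2 fun M hM => ?_⟩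
    have hΦ : (QuotientGroup.mk' (frattini G)).ker ≤ M := by
      rw [QuotientGroup.ker_mk']; exact frattini_le_coatom hM
    have hs := QuotientGroup.mk'_surjective (frattini G)
    have hMc : (M.map (QuotientGroup.mk' (frattini G))).comap (QuotientGroup.mk' (frattini G)) = M :=
      Subgroup.comap_map_eq_self hΦ
    have hcoatom : IsCoatom (M.map (QuotientGroup.mk' (frattini G))) := by
      refine ⟨fun h0 => hM.1 ?_, fun T hT => ?_⟩
      · rw [← hMc, h0, Subgroup.comap_top]
      · have h1 : M < T.comap (QuotientGroup.mk' (frattini G)) := by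
          rw [← hMc]
          exact (Subgroup.comap_lt_comap_of_surjective hs).2 hT
        rw [← Subgroup.map_comap_eq_self_of_surjective hs T, hM.2 _ h1,
          Subgroup.map_top_of_surjective _ hs]
    have hmax : ∀ T : Subgroup (G ⧸ frattini G), IsCoatom T → T.Normal :=
      ((Group.isNilpotent_of_finite_tfae (G := G ⧸ frattini G)).out 0 2).1 this
    have hn := hmax _ hcoatom
    rw [← hMc]
    exact hn.comap _

/-- If the minimal normal subgroup `M = A/B` of `G/B` satisfied `[M, G/B] = M`, it would lie in
every term of the lower central series; so `[M, G/B] = 1`. -/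
theorem IsChiefFactor.factorCentralizer_eq_top {G : Type u} [Group G] [Group.IsNilpotent G]
    {A B : Subgroup G} [A.Normal] [B.Normal] (h : IsChiefFactor A B) :
    factorCentralizer A B = ⊤ := by
  have hMn : (A.map (QuotientGroup.mk' B)).Normal :=
    ‹A.Normal›.map _ (QuotientGroup.mk'_surjective B)
  have hM0 : A.map (QuotientGroup.mk' B) ≠ ⊥ := fun h0 => by
    rw [Subgroup.map_eq_bot_iff, QuotientGroup.ker_mk'] at h0
    exact h.1.not_ge h0
  have hcomm : ⁅A.map (QuotientGroup.mk' B), (⊤ : Subgroup (G ⧸ B))⁆ = ⊥ := by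
    refine (h.map_minimal _ inferInstance (Subgroup.commutator_le_left _ _)).resolve_right
      fun h1 => hM0 ?_
    have h2 : ∀ n, A.map (QuotientGroup.mk' B) ≤ (⊤ : Subgroup (G ⧸ B)).lowerCentralSeries n := by
      intro n
      induction n with
      | zero => exact le_top
      | succ n ih =>
        rw [← h1, Subgroup.lowerCentralSeries_succ]
        exact Subgroup.commutator_mono ih le_rfl
    obtain ⟨n, hn⟩ := Subgroup.nilpotent_iff_lowerCentralSeries.1
      (inferInstance : Group.IsNilpotent (G ⧸ B))
    exact le_bot_iff.1 (hn ▸ h2 n)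
  rw [eq_top_iff, le_factorCentralizer_iff, Subgroup.le_centralizer_iff]
  exact (Subgroup.commutator_eq_bot_iff_le_centralizer.1 hcomm).trans
    (Subgroup.centralizer_le le_top)

/-- Descending induction on `L`: for a chief factor `R/L`, the group `G/L` is a central extension of
`G/R` by `R/L`. -/
theorem isNilpotent_of_factorCentralizer_eq_top {G : Type u} [Group G] [Finite G]
    [Group.IsSolvable G]
    (h : ∀ (p : Nat.Primes) (A B : Subgroup G) [A.Normal] [B.Normal], IsChiefFactor A B →
      (∃ k : ℕ, B.relIndex A = (p : ℕ) ^ k) → factorCentralizer A B = ⊤)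
    (L : Subgroup G) (hL : L.Normal) : Group.IsNilpotent (G ⧸ L) := by
  induction L using WellFoundedGT.induction with
  | ind L ih =>
  rcases eq_or_ne L ⊤ with rfl | hne
  · have := QuotientGroup.subsingleton_quotient_top (G := G)
    infer_instance
  obtain ⟨R, hR, -, hc, q, k, hq, hk⟩ := exists_chiefFactor (lt_top_iff_ne_top.2 hne)
  have := ih R hc.1 hR
  have h1 := (h ⟨q, hq⟩ R L hc ⟨k, hk⟩).ge
  rw [le_factorCentralizer_iff, Subgroup.le_centralizer_iff,
    Subgroup.map_top_of_surjective _ (QuotientGroup.mk'_surjective L), Subgroup.coe_top,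
    Subgroup.centralizer_univ] at h1
  have hLR : L ≤ R := hc.1.le
  refine Subgroup.isNilpotent_of_ker_le_center
    (QuotientGroup.map L R (MonoidHom.id G) hLR) (le_trans (fun x hx => ?_) h1)
  obtain ⟨g, rfl⟩ := QuotientGroup.mk'_surjective L x
  exact ⟨g, (QuotientGroup.eq_one_iff g).1 hx, rfl⟩

theorem isIntegratedLocalDefinition_finiteNilpotent :
    IsIntegratedLocalDefinition FiniteNilpotent.{u} trivialFormation.{u} := by
  have hloc : ∀ (G : Type u) [Group G], FiniteNilpotent G ↔ Loc trivialFormation G := by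
    intro G _
    constructor
    · rintro ⟨h1, h2⟩
      exact ⟨h1, inferInstance, fun p A B _ _ h _ =>
        (subsingleton_quotient_iff _).2 h.factorCentralizer_eq_top⟩
    · rintro ⟨h1, h2, h3⟩
      have := isNilpotent_of_factorCentralizer_eq_top
        (fun p A B _ _ h hk => (subsingleton_quotient_iff _).1 (h3 p A B h hk)) ⊥ inferInstance
      exact ⟨h1, Group.nilpotent_of_mulEquiv QuotientGroup.quotientBot⟩
  refine ⟨isSaturatedFormation_finiteNilpotent, fun G _ h => ?_, isFormation_trivialFormation,
    hloc, fun p G _ h => (hloc G).1 ?_⟩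
  · have := h.2
    infer_instance
  · have : Subsingleton G := h
    exact ⟨inferInstance, inferInstance⟩

/-! ### The example: the groups -/

/-- The three-cycle generating `exampleU`. -/
abbrev exampleCycle : Equiv.Perm (Fin 6) := Equiv.swap 0 1 * Equiv.swap 1 2

/-- The permutation interchanging the two blocks of symbols. -/
abbrev exampleSwap : Equiv.Perm (Fin 6) := Equiv.swap 0 3 * Equiv.swap 1 4 * Equiv.swap 2 5

theorem perm_apply_inv_apply {α : Type u} (g : Equiv.Perm α) (i : α) : g (g⁻¹ i) = i :=
  g.apply_symm_apply i

theorem exampleCycle_mem : exampleCycle ∈ exampleG :=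
  Subgroup.subset_closure (.inl (by decide : ∀ i : Fin 6, 3 ≤ i → exampleCycle i = i))

theorem exampleSwap_mem : exampleSwap ∈ exampleG :=
  Subgroup.subset_closure (.inr rfl)

theorem eq_of_mem_zpowers_exampleCycle {g : Equiv.Perm (Fin 6)}
    (hg : g ∈ Subgroup.zpowers exampleCycle) :
    g = 1 ∨ g = exampleCycle ∨ g = exampleCycle⁻¹ := by
  obtain ⟨k, rfl⟩ := hg
  have h3 : exampleCycle ^ (3 : ℤ) = 1 := by decide
  have hk : exampleCycle ^ k = exampleCycle ^ (k % 3) := by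
    conv_lhs => rw [← Int.emod_add_mul_ediv k 3, zpow_add, zpow_mul, h3, one_zpow, mul_one]
  have h : k % 3 = 0 ∨ k % 3 = 1 ∨ k % 3 = 2 := by omega
  simp only [hk]
  rcases h with h | h | h <;> rw [h]
  · exact .inl (zpow_zero _)
  · exact .inr (.inl (zpow_one _))
  · exact .inr (.inr (by decide))

theorem exampleG_block (g : Equiv.Perm (Fin 6)) (hg : g ∈ exampleG) :
    (∀ i, i < 3 ↔ g i < 3) ∨ ∀ i, i < 3 ↔ ¬ g i < 3 := by
  induction hg using Subgroup.closure_induction with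
  | mem g hg =>
    rcases hg with hg | rfl
    · refine .inl fun i => ⟨fun hi => ?_, fun hi => ?_⟩
      · by_contra h
        have := g.injective (hg (g i) (not_lt.1 h))
        rw [this] at h; exact h hi
      · by_contra h
        exact h (hg i (not_lt.1 h) ▸ hi)
    · exact .inr (by decide)
  | one => exact .inl fun i => Iff.rfl
  | mul g h _ _ hg hh =>
    simp only [Equiv.Perm.mul_apply]
    rcases hg with hg | hg <;> rcases hh with hh | hh
    · exact .inl fun i => (hh i).trans (hg _)
    · exact .inr fun i => (hh i).trans (not_congr (hg _))
    · exact .inr fun i => (hh i).trans (hg _)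
    · exact .inl fun i => (hh i).trans ((not_congr (hg _)).trans not_not)
  | inv g _ hg =>
    rcases hg with hg | hg
    · exact .inl fun i => by simpa using (hg (g⁻¹ i)).symm
    · refine .inr fun i => ?_
      have := hg (g⁻¹ i)
      rw [perm_apply_inv_apply] at this
      tauto

/-- The stabiliser in `exampleG` of the two blocks. -/
def exampleH : Subgroup exampleG where
  carrier := {g | ∀ i, i < 3 ↔ (g : Equiv.Perm (Fin 6)) i < 3}
  one_mem' i := Iff.rfl
  mul_mem' {g h} hg hh i := (hh i).trans (hg _)
  inv_mem' {g} hg i := by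
    change i < 3 ↔ (g : Equiv.Perm (Fin 6))⁻¹ i < 3
    have := hg ((g : Equiv.Perm (Fin 6))⁻¹ i)
    rw [perm_apply_inv_apply] at this
    exact this.symm

theorem exampleH_normal : exampleH.Normal := by
  refine ⟨fun n hn g i => ?_⟩
  have hn : ∀ i, i < 3 ↔ (n : Equiv.Perm (Fin 6)) i < 3 := hn
  change i < 3 ↔ (g : Equiv.Perm (Fin 6)) ((n : Equiv.Perm (Fin 6))
    ((g : Equiv.Perm (Fin 6))⁻¹ i)) < 3
  have h1 := hn ((g : Equiv.Perm (Fin 6))⁻¹ i)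
  rcases exampleG_block g g.2 with h | h
  · have h2 := h ((g : Equiv.Perm (Fin 6))⁻¹ i)
    rw [perm_apply_inv_apply] at h2
    rw [← h, ← h1, h2]
  · have h2 := h ((g : Equiv.Perm (Fin 6))⁻¹ i)
    rw [perm_apply_inv_apply] at h2
    have h3 := h ((n : Equiv.Perm (Fin 6)) ((g : Equiv.Perm (Fin 6))⁻¹ i))
    tauto

set_option maxRecDepth 4000 in
theorem swap_mul_swap_of_lt : ∀ a b d : Fin 6, a < 3 → b < 3 → d < 3 → a ≠ b → b ≠ d → a ≠ d →
    Equiv.swap a b * Equiv.swap b d = exampleCycle ∨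
      Equiv.swap a b * Equiv.swap b d = exampleCycle⁻¹ := by
  decide

theorem conj_exampleCycle_mem (g : Equiv.Perm (Fin 6)) (hg : ∀ i, i < 3 ↔ g i < 3) :
    g * exampleCycle * g⁻¹ ∈ Subgroup.zpowers exampleCycle := by
  have h1 : g * exampleCycle * g⁻¹ = Equiv.swap (g 0) (g 1) * Equiv.swap (g 1) (g 2) := by
    rw [Equiv.swap_apply_apply, Equiv.swap_apply_apply]
    group
  rw [h1]
  rcases swap_mul_swap_of_lt (g 0) (g 1) (g 2) ((hg 0).1 (by decide)) ((hg 1).1 (by decide))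
    ((hg 2).1 (by decide)) (g.injective.ne (by decide)) (g.injective.ne (by decide))
    (g.injective.ne (by decide)) with h | h <;> rw [h]
  · exact Subgroup.mem_zpowers _
  · exact inv_mem (Subgroup.mem_zpowers _)

/-- `U` is normal in the block stabiliser, which is normal in `G`. -/
theorem exampleU_isSubnormal : exampleU.IsSubnormal := by
  have hle : exampleU ≤ exampleH := by
    intro u hu
    change ∀ i, i < 3 ↔ (u : Equiv.Perm (Fin 6)) i < 3
    rcases eq_of_mem_zpowers_exampleCycle (Subgroup.mem_subgroupOf.1 hu) with h | h | h <;>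
      rw [h] <;> decide
  refine .step _ _ hle exampleH_normal.isSubnormal ⟨fun n hn g => ?_⟩
  obtain ⟨k, hk⟩ := Subgroup.mem_subgroupOf.1 (Subgroup.mem_subgroupOf.1 hn)
  refine Subgroup.mem_subgroupOf.2 (Subgroup.mem_subgroupOf.2 ?_)
  change ((g : exampleG) : Equiv.Perm (Fin 6)) * ((n : exampleG) : Equiv.Perm (Fin 6)) *
    ((g : exampleG) : Equiv.Perm (Fin 6))⁻¹ ∈ _
  rw [← hk]
  change _ * exampleCycle ^ k * _ ∈ _
  rw [← conj_zpow]
  exact Subgroup.zpow_mem _ (conj_exampleCycle_mem _ g.2) k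

theorem finiteNilpotent_exampleU : FiniteNilpotent exampleU := by
  refine ⟨inferInstance, ?_⟩
  -- The trivial homomorphism has the whole group as kernel, so commutativity suffices.
  refine Subgroup.isNilpotent_of_ker_le_center (1 : exampleU →* Unit) fun u _ =>
    Subgroup.mem_center_iff.2 fun v => Subtype.ext (Subtype.ext ?_)
  obtain ⟨k, hk⟩ := Subgroup.mem_subgroupOf.1 u.2
  obtain ⟨l, hl⟩ := Subgroup.mem_subgroupOf.1 v.2
  change ((v : exampleG) : Equiv.Perm (Fin 6)) * ((u : exampleG) : Equiv.Perm (Fin 6)) =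
    ((u : exampleG) : Equiv.Perm (Fin 6)) * ((v : exampleG) : Equiv.Perm (Fin 6))
  refine Eq.trans (congrArg₂ _ hl.symm hk.symm) (Eq.trans ?_ (congrArg₂ _ hk hl))
  exact Commute.zpow_zpow_self exampleCycle l k

/-! ### The example: the permutation module -/

section Module

variable (F : Type w) [Field F]

theorem exampleV_apply (g : exampleG) (x : Fin 6 →₀ F) (i : Fin 6) :
    exampleV F g x i = x ((g : Equiv.Perm (Fin 6))⁻¹ i) :=
  Finsupp.mapDomain_equiv_apply (f := (g : Equiv.Perm (Fin 6))) x i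

theorem exampleV_single (g : exampleG) (i : Fin 6) :
    exampleV F g (exampleBasis F i) = exampleBasis F ((g : Equiv.Perm (Fin 6)) i) :=
  Finsupp.mapDomain_single

theorem mem_examplePlus_iff {x : Fin 6 →₀ F} :
    x ∈ Submodule.span F {exampleBasis F 0 + exampleBasis F 1 + exampleBasis F 2,
      exampleBasis F 3, exampleBasis F 4, exampleBasis F 5} ↔ x 0 = x 1 ∧ x 1 = x 2 := by
  simp only [Submodule.mem_span_insert, Submodule.mem_span_singleton]
  constructor
  · rintro ⟨a, _, ⟨b, _, ⟨c, _, ⟨d, rfl⟩, rfl⟩, rfl⟩, rfl⟩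
    simp
  · rintro ⟨h1, h2⟩
    refine ⟨x 0, _, ⟨x 3, _, ⟨x 4, _, ⟨x 5, rfl⟩, rfl⟩, rfl⟩, ?_⟩
    ext i
    fin_cases i <;> simp [h1, h2]

theorem mem_exampleMinus_iff {x : Fin 6 →₀ F} :
    x ∈ Submodule.span F {exampleBasis F 0 + exampleBasis F 1,
      exampleBasis F 1 + exampleBasis F 2} ↔
      x 1 = x 0 + x 2 ∧ x 3 = 0 ∧ x 4 = 0 ∧ x 5 = 0 := by
  simp only [Submodule.mem_span_insert, Submodule.mem_span_singleton]
  constructor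
  · rintro ⟨a, _, ⟨b, rfl⟩, rfl⟩
    simp
  · rintro ⟨h1, h2, h3, h4⟩
    refine ⟨x 0, _, ⟨x 2, rfl⟩, ?_⟩
    ext i
    fin_cases i <;> simp [h1, h2, h3, h4]

theorem restrictTo_exampleV_eq (u : exampleU) :
    (∀ x : Fin 6 →₀ F, restrictTo (exampleV F) exampleU u x = x) ∨
    (∀ (x : Fin 6 →₀ F) i, restrictTo (exampleV F) exampleU u x i = x (exampleCycle⁻¹ i)) ∨
    ∀ (x : Fin 6 →₀ F) i, restrictTo (exampleV F) exampleU u x i = x (exampleCycle i) := by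
  rcases eq_of_mem_zpowers_exampleCycle (Subgroup.mem_subgroupOf.1 u.2) with h | h | h
  · refine .inl fun x => Finsupp.ext fun i => (exampleV_apply F u x i).trans ?_
    rw [h]; rfl
  · refine .inr (.inl fun x i => (exampleV_apply F u x i).trans ?_)
    rw [h]
  · refine .inr (.inr fun x i => (exampleV_apply F u x i).trans ?_)
    rw [h, inv_inv]

theorem exampleCycle_apply : exampleCycle 0 = 1 ∧ exampleCycle 1 = 2 ∧ exampleCycle 2 = 0 ∧
    exampleCycle 3 = 3 ∧ exampleCycle 4 = 4 ∧ exampleCycle 5 = 5 := by decide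

theorem exampleCycle_inv_apply : exampleCycle⁻¹ 0 = 2 ∧ exampleCycle⁻¹ 1 = 0 ∧
    exampleCycle⁻¹ 2 = 1 ∧ exampleCycle⁻¹ 3 = 3 ∧ exampleCycle⁻¹ 4 = 4 ∧
    exampleCycle⁻¹ 5 = 5 := by decide

theorem restrictTo_exampleV_of_mem_plus (u : exampleU) {x : Fin 6 →₀ F}
    (hx : x 0 = x 1 ∧ x 1 = x 2) : restrictTo (exampleV F) exampleU u x = x := by
  obtain ⟨h1, h2⟩ := hx
  obtain ⟨a0, a1, a2, a3, a4, a5⟩ := exampleCycle_apply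
  obtain ⟨b0, b1, b2, b3, b4, b5⟩ := exampleCycle_inv_apply
  rcases restrictTo_exampleV_eq F u with h | h | h
  · exact h x
  · ext i; rw [h]; fin_cases i
    exacts [b0.symm ▸ (h1.trans h2).symm, b1.symm ▸ h1, b2.symm ▸ h2, b3.symm ▸ rfl,
      b4.symm ▸ rfl, b5.symm ▸ rfl]
  · ext i; rw [h]; fin_cases i
    exacts [a0.symm ▸ h1.symm, a1.symm ▸ h2.symm, a2.symm ▸ h1.trans h2, a3.symm ▸ rfl,
      a4.symm ▸ rfl, a5.symm ▸ rfl]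

/-- The component `V⁺` of the example. -/
noncomputable def examplePlus : Subrepresentation (restrictTo (exampleV F) exampleU) where
  toSubmodule := Submodule.span F {exampleBasis F 0 + exampleBasis F 1 + exampleBasis F 2,
      exampleBasis F 3, exampleBasis F 4, exampleBasis F 5}
  apply_mem_toSubmodule u x hx := by
    rw [restrictTo_exampleV_of_mem_plus F u ((mem_examplePlus_iff F).1 hx)]
    exact hx

variable [CharP F 2]

/-- The component `V⁻` of the example. -/
noncomputable def exampleMinus : Subrepresentation (restrictTo (exampleV F) exampleU) where
  toSubmodule := Submodule.span F {exampleBasis F 0 + exampleBasis F 1,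
      exampleBasis F 1 + exampleBasis F 2}
  apply_mem_toSubmodule u x hx := by
    have hx' := (mem_exampleMinus_iff F).1 hx
    obtain ⟨a0, a1, a2, a3, a4, a5⟩ := exampleCycle_apply
    obtain ⟨b0, b1, b2, b3, b4, b5⟩ := exampleCycle_inv_apply
    obtain ⟨h1, h2, h3, h4⟩ := hx'
    rcases restrictTo_exampleV_eq F u with h | h | h
    · rwa [h x]
    · rw [mem_exampleMinus_iff]
      simp only [h, b0, b1, b2, b3, b4, b5, h1, h2, h3, h4, and_true]
      rw [add_comm, add_assoc, CharTwo.add_self_eq_zero, add_zero]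
    · rw [mem_exampleMinus_iff]
      simp only [h, a0, a1, a2, a3, a4, a5, h1, h2, h3, h4, and_true]
      rw [add_right_comm, CharTwo.add_self_eq_zero, zero_add]

theorem isCompl_example : IsCompl (examplePlus F) (exampleMinus F) := by
  rw [isCompl_iff_toSubmodule, isCompl_iff, Submodule.disjoint_def, codisjoint_iff,
    Submodule.eq_top_iff']
  refine ⟨fun x hx hx' => ?_, fun x => ?_⟩
  · obtain ⟨h1, h2⟩ := (mem_examplePlus_iff F).1 hx
    obtain ⟨h3, h4, h5, h6⟩ := (mem_exampleMinus_iff F).1 hx'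
    rw [h1, ← h2, CharTwo.add_self_eq_zero] at h3
    ext i
    fin_cases i
    exacts [h1.trans h3, h3, h2.symm.trans h3, h4, h5, h6]
  -- `y` is the image of `x` under the sum over `U`, since `|U| = 3 = 1` in `F`.
  · let y : Fin 6 →₀ F := (x 0 + x 1 + x 2) • (exampleBasis F 0 + exampleBasis F 1 +
      exampleBasis F 2) + x 3 • exampleBasis F 3 + x 4 • exampleBasis F 4 + x 5 • exampleBasis F 5
    rw [← add_sub_cancel y x]
    refine Submodule.add_mem_sup ((mem_examplePlus_iff F).2 ?_) ((mem_exampleMinus_iff F).2 ?_)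
    · simp [y]
    · have h2 : (2 : F) = 0 := CharTwo.two_eq_zero
      simp [y]
      linear_combination (x 1) * h2

theorem areComponents_example :
    AreComponents trivialFormation ⟨2, Nat.prime_two⟩ (examplePlus F) (exampleMinus F) where
  isCompl := isCompl_example F
  hypercentral A B _ := by
    refine (subsingleton_quotient_iff _).2 (eq_top_iff.2 fun u _ => mem_ker_factorRep.2 fun b _ => ?_)
    have : (examplePlus F).toRepresentation u b = b :=
      Subtype.ext (restrictTo_exampleV_of_mem_plus F u ((mem_examplePlus_iff F).1 b.2))
    rw [this, sub_self]
    exact Submodule.zero_mem _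
  hypereccentric A B hAB h := by
    have htop := (subsingleton_quotient_iff _).1 h
    refine hAB.lt.not_ge fun b hb => ?_
    let c : exampleU := ⟨⟨exampleCycle, exampleCycle_mem⟩, Subgroup.mem_zpowers exampleCycle⟩
    have h1 := mem_ker_factorRep.1 (htop.ge (Subgroup.mem_top c)) b hb
    have h2 := mem_ker_factorRep.1 (htop.ge (Subgroup.mem_top c⁻¹)) b hb
    -- On `V⁻` one has `1 + c + c⁻¹ = 0`, so `(c - 1) + (c⁻¹ - 1) = -3 = 1` in characteristic 2. If
    -- `c` acted trivially on `B/A`, this would put `b` in `A`.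
    have hsum : ((exampleMinus F).toRepresentation c b - b) +
        ((exampleMinus F).toRepresentation c⁻¹ b - b) = b := by
      obtain ⟨h3, h4, h5, h6⟩ := (mem_exampleMinus_iff F).1 b.2
      have two : (2 : F) = 0 := CharTwo.two_eq_zero
      obtain ⟨a0, a1, a2, a3, a4, a5⟩ := exampleCycle_apply
      obtain ⟨b0, b1, b2, b3, b4, b5⟩ := exampleCycle_inv_apply
      refine Subtype.ext (Finsupp.ext fun i => ?_)
      change (exampleV F c b i - (b : Fin 6 →₀ F) i) +
        (exampleV F (c⁻¹ : exampleU) b i - (b : Fin 6 →₀ F) i) = (b : Fin 6 →₀ F) i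
      rw [exampleV_apply, exampleV_apply]
      change ((b : Fin 6 →₀ F) (exampleCycle⁻¹ i) - (b : Fin 6 →₀ F) i) +
        ((b : Fin 6 →₀ F) (exampleCycle i) - (b : Fin 6 →₀ F) i) = (b : Fin 6 →₀ F) i
      fin_cases i <;> simp only [Fin.mk_zero, Fin.mk_one, Fin.reduceFinMk, a0, a1,
        a2, a3, a4, a5, b0, b1, b2, b3, b4, b5, h3, h4, h5, h6]
      -- The last three coordinates are zero; the three linear combinations serve the coordinates 0,
      -- 1 and 2.
      all_goals first
        | (simp; done)
        | linear_combination ((b : Fin 6 →₀ F) 2 - (b : Fin 6 →₀ F) 0) * two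
        | linear_combination (-(b : Fin 6 →₀ F) 2 - (b : Fin 6 →₀ F) 0) * two
        | linear_combination ((b : Fin 6 →₀ F) 0 - (b : Fin 6 →₀ F) 2) * two
    have := A.toSubmodule.add_mem h1 h2
    rwa [hsum] at this

omit [CharP F 2] in
theorem not_isStableUnder_examplePlus :
    ¬ IsStableUnder (exampleV F) (examplePlus F).toSubmodule := by
  intro h
  have h1 := h ⟨exampleSwap, exampleSwap_mem⟩ (exampleBasis F 3)
    ((mem_examplePlus_iff F).2 (by simp))
  rw [exampleV_single, show exampleSwap 3 = 0 by decide] at h1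
  simpa using ((mem_examplePlus_iff F).1 h1).1

theorem not_isStableUnder_exampleMinus :
    ¬ IsStableUnder (exampleV F) (exampleMinus F).toSubmodule := by
  intro h
  have h1 := h ⟨exampleSwap, exampleSwap_mem⟩ (exampleBasis F 0 + exampleBasis F 1)
    ((mem_exampleMinus_iff F).2 (by simp))
  rw [map_add, exampleV_single, exampleV_single, show exampleSwap 0 = 3 by decide,
    show exampleSwap 1 = 4 by decide] at h1
  simpa using ((mem_exampleMinus_iff F).1 h1).2.1

end Module

theorem mainTheorem5 :
    -- the theorem
    (∀ (X : GroupClass.{u}) (f : Nat.Primes → GroupClass.{u}), IsIntegratedLocalDefinition X f →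
      ∀ (p : Nat.Primes) (F : Type w) [Field F] [CharP F p]
        (G : Type u) [Group G] [Finite G] (U : Subgroup G), U.Normal → X U →
      ∀ (V : Type v) [AddCommGroup V] [Module F V] (ρ : Representation F G V),
        (∃! W : Subrepresentation (restrictTo ρ U) × Subrepresentation (restrictTo ρ U),
          AreComponents f p W.1 W.2) ∧
        ∀ P M : Subrepresentation (restrictTo ρ U), AreComponents f p P M →
          IsStableUnder ρ P.toSubmodule ∧ IsStableUnder ρ M.toSubmodule) ∧
    -- the example: subnormality of `U` is not enough
    (IsIntegratedLocalDefinition FiniteNilpotent.{0} trivialFormation.{0} ∧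
      exampleU.IsSubnormal ∧ FiniteNilpotent exampleU ∧
      ∀ (F : Type w) [Field F] [CharP F 2],
        ∃ P M : Subrepresentation (restrictTo (exampleV F) exampleU),
          P.toSubmodule = Submodule.span F
            {exampleBasis F 0 + exampleBasis F 1 + exampleBasis F 2,
              exampleBasis F 3, exampleBasis F 4, exampleBasis F 5} ∧
          M.toSubmodule = Submodule.span F
            {exampleBasis F 0 + exampleBasis F 1, exampleBasis F 1 + exampleBasis F 2} ∧
          AreComponents trivialFormation ⟨2, Nat.prime_two⟩ P M ∧
          ¬ IsStableUnder (exampleV F) P.toSubmodule ∧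
          ¬ IsStableUnder (exampleV F) M.toSubmodule) := by
  refine ⟨fun X f hX p F _ _ G _ _ U hU hXU V _ _ ρ => ?_,
    isIntegratedLocalDefinition_finiteNilpotent, exampleU_isSubnormal, finiteNilpotent_exampleU,
    fun F _ _ => ⟨examplePlus F, exampleMinus F, rfl, rfl, areComponents_example F,
      not_isStableUnder_examplePlus F, not_isStableUnder_exampleMinus F⟩⟩
  obtain ⟨P₀, M₀, h₀, hstable, huniq⟩ := exists_stable_components hX p U hXU ρ
  refine ⟨⟨(P₀, M₀), h₀, fun W hW => Prod.ext (huniq _ _ hW).1 (huniq _ _ hW).2⟩,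
    fun P M h => ?_⟩
  obtain ⟨rfl, rfl⟩ := huniq P M h
  exact hstable
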